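/- All groups are finite. A \emph{surjective group sequence of length $\ell$} is a chain of surjective homomorphisms $S_\ell \xrightarrow{\pi_\ell} S_{\ell-1} \to \cdots \to S_1 \xrightarrow{\pi_1} S_0 = 1$. Two such sequences $S_1 = ((S_{i;1}),(\pi_{i;1}))$ and $S_2 = ((S_{i;2}),(\pi_{i;2}))$ of length $\ell$ are \emph{compatible} if $\ker(\pi_{i;1}) \cong \ker(\pi_{i;2})$ for every $1 \le i \le \ell$. For $A \le \operatorname{Aut}(G)$ and $H \le G$, let $A^H := \{\sigma|_H : \sigma \in A,\ \sigma(H) = H\} \le \operatorname{Aut}(H)$, and for an isomorphism $f : G_1 \to G_2$ let $f_\bullet : \operatorname{Aut}(G_1) \to \operatorname{Aut}(G_2)$, $\alpha \mapsto f \circ \alpha \circ f^{-1}$. A homomorphism $p : G \to L$ is \emph{trivially extendable} at $N \le L$ if $p^{-1}(M) \cong M \times \ker(p)$ for every subgroup $M \le N$. Let $\ell \ge 2$ and let $S_1, S_2$ be compatible surjective group sequences of length $\ell$ with $(S_1,S_2) \in \mathbf{Comp}_\ell$, that is, for every $i$ with $2 \le i \le \ell-1$ there is an isomorphism $\sigma_i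 : \ker(\pi_{i;1}) \to \ker(\pi_{i;2})$ such that \[(\sigma_i)_\bullet\bigl(\operatorname{Inn}(S_{i;1})^{\ker(\pi_{i;1})}\bigr) \le \operatorname{Aut}(S_{i;2})^{\ker(\pi_{i;2})} \quad\text{and}\quad (\sigma_i^{-1})_\bullet\bigl(\operatorname{Inn}(S_{i;2})^{\ker(\pi_{i;2})}\bigr) \le \operatorname{Aut}(S_{i;1})^{\ker(\pi_{i;1})}\] (for $\ell = 2$ this condition is empty). Then there exists a good witness system associated with $(S_1,S_2)$: a finite group $G$ with surjective homomorphisms $p_1 : G \to S_{\ell;1}$ and $p_2 : G \to S_{\ell;2}$ such that $\ker(p_1) \cong \ker(p_2)$ and, for $\delta \in \{1,2\}$, $p_\delta$ is trivially extendable at $\ker(\pi_{\ell;\delta})$. In particular, $S_{\ell;1}$ and $S_{\ell;2}$ are compatible: there is a finite group $G$ with isomorphic normal subgroups $N_1$ and $N_2$ such that $S_{\ell;1} \cong G/N_1$ and $S_{\ell;2} \cong G/N_2$. -/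

import Mathlib

universe u

/-- Two (finite) groups `L₁`, `L₂` are compatible if some finite group `G` has isomorphic normal
subgroups `N₁`, `N₂` with `L₁ ≅ G ⧸ N₁` and `L₂ ≅ G ⧸ N₂`. -/
def CompatibleGroups (L₁ L₂ : Type u) [Group L₁] [Group L₂] : Prop :=
  ∃ (G : Type u) (_ : Group G) (_ : Finite G) (N₁ N₂ : Subgroup G) (_ : N₁.Normal)
    (_ : N₂.Normal),
    Nonempty (N₁ ≃* N₂) ∧ Nonempty (L₁ ≃* G ⧸ N₁) ∧ Nonempty (L₂ ≃* G ⧸ N₂)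

/-- A sequence `S_ℓ → ⋯ → S_1 → S_0 = 1` of finite groups and homomorphisms. The map
`S_{i+1} → S_i` is `hom i`, for `0 ≤ i < ℓ`. -/
structure GroupSequence (ℓ : ℕ) where
  obj : Fin (ℓ + 1) → Type u
  [group : ∀ i, Group (obj i)]
  [finite : ∀ i, Finite (obj i)]
  obj_zero : Subsingleton (obj 0)
  hom : ∀ i : Fin ℓ, obj i.succ →* obj i.castSucc

attribute [instance] GroupSequence.group GroupSequence.finite

namespace GroupSequence

variable {ℓ : ℕ}

/-- All the maps of the sequence are surjective. -/
def IsSurjective (S : GroupSequence.{u} ℓ) : Prop :=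
  ∀ i, Function.Surjective (S.hom i)

/-- The top group `S_ℓ`. -/
abbrev top (S : GroupSequence.{u} ℓ) : Type u := S.obj (Fin.last ℓ)

/-- The kernel of the top map `S_ℓ → S_{ℓ-1}`. (A sequence of length `0` has no top map;
there the value `⊤` is a mere convention.) -/
def topKer : {ℓ : ℕ} → (S : GroupSequence.{u} ℓ) → Subgroup S.top
  | 0, _ => ⊤
  | n + 1, S => (S.hom (Fin.last n)).ker

/-- Surjective group sequences of the same length with isomorphic kernels at each step. -/
def Compatible (S₁ S₂ : GroupSequence.{u} ℓ) : Prop :=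
  S₁.IsSurjective ∧ S₂.IsSurjective ∧
    ∀ i, Nonempty ((S₁.hom i).ker ≃* (S₂.hom i).ker)

end GroupSequence

/-- For `A ≤ Aut(G)` and `H ≤ G`, the group of all restrictions to `H` of those `σ ∈ A` with
`σ(H) = H`. -/
def restrictAut {G : Type u} [Group G] (A : Subgroup (MulAut G)) (H : Subgroup G) :
    Subgroup (MulAut H) where
  carrier := {τ | ∃ σ ∈ A, H.map σ.toMonoidHom = H ∧ ∀ h : H, ((τ h : H) : G) = σ (h : G)}
  one_mem' := ⟨1, A.one_mem, by ext; simp, fun _ => rfl⟩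
  mul_mem' := by
    rintro τ τ' ⟨σ, hσ, hH, h⟩ ⟨σ', hσ', hH', h'⟩
    refine ⟨σ * σ', A.mul_mem hσ hσ', ?_, fun x => ?_⟩
    · have : (σ * σ').toMonoidHom = σ.toMonoidHom.comp σ'.toMonoidHom := rfl
      rw [this, ← Subgroup.map_map, hH', hH]
    · rw [MulAut.mul_apply, MulAut.mul_apply, h, h']
  inv_mem' := by
    rintro τ ⟨σ, hσ, hH, h⟩
    refine ⟨σ⁻¹, A.inv_mem hσ, ?_, fun x => ?_⟩
    · have : (σ⁻¹).toMonoidHom.comp σ.toMonoidHom = MonoidHom.id G := by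
        ext x; exact σ.symm_apply_apply x
      conv_lhs => rw [← hH]
      rw [Subgroup.map_map, this, Subgroup.map_id]
    · have hx := h (τ⁻¹ x)
      rw [MulAut.apply_inv_self] at hx
      rw [hx, MulAut.inv_apply_self]

/-- The group of inner automorphisms. -/
def innAut (G : Type u) [Group G] : Subgroup (MulAut G) := (MulAut.conj (G := G)).range

/-- Pairs of compatible group sequences of length `ℓ` such that, for `2 ≤ i ≤ ℓ - 1`, some
isomorphism `σ : ker(π_{i;1}) → ker(π_{i;2})` satisfies
`σ_• (Inn(S_{i;1})^{ker π_{i;1}}) ≤ Aut(S_{i;2})^{ker π_{i;2}}` and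
`(σ⁻¹)_• (Inn(S_{i;2})^{ker π_{i;2}}) ≤ Aut(S_{i;1})^{ker π_{i;1}}`.
Since `π_{i+1}` is `hom i`, the index below runs over `1 ≤ i` with `i + 1 ≤ ℓ - 1`.
`MulAut.congr f` is the map `α ↦ f ∘ α ∘ f⁻¹`. -/
def IsComp {ℓ : ℕ} (S₁ S₂ : GroupSequence.{u} ℓ) : Prop :=
  S₁.Compatible S₂ ∧
    ∀ i : Fin ℓ, 1 ≤ (i : ℕ) → (i : ℕ) + 1 < ℓ →
      ∃ σ : (S₁.hom i).ker ≃* (S₂.hom i).ker,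
        (restrictAut (innAut (S₁.obj i.succ)) (S₁.hom i).ker).map
            (MulAut.congr σ).toMonoidHom ≤ restrictAut ⊤ (S₂.hom i).ker ∧
        (restrictAut (innAut (S₂.obj i.succ)) (S₂.hom i).ker).map
            (MulAut.congr σ.symm).toMonoidHom ≤ restrictAut ⊤ (S₁.hom i).ker

/-- `π⁻¹(M) ≅ M × ker π` for every `M ≤ N`. -/
def TriviallyExtendable {G H : Type u} [Group G] [Group H] (π : G →* H) (N : Subgroup H) :
    Prop :=
  ∀ M : Subgroup H, M ≤ N → Nonempty (M.comap π ≃* M × π.ker)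

/-- `(G, p₁, p₂)` is a witness system for the compatibility of `L₁` and `L₂`: `G` is finite and
`p₁`, `p₂` are surjective with isomorphic kernels. -/
def IsWitnessSystem {G L₁ L₂ : Type u} [Group G] [Group L₁] [Group L₂]
    (p₁ : G →* L₁) (p₂ : G →* L₂) : Prop :=
  Finite G ∧ Function.Surjective p₁ ∧ Function.Surjective p₂ ∧ Nonempty (p₁.ker ≃* p₂.ker)

/-- A witness system that is good with respect to subgroups `N₁ ≤ L₁` and `N₂ ≤ L₂`. -/
def IsGoodWitnessSystem {G L₁ L₂ : Type u} [Group G] [Group L₁] [Group L₂]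
    (p₁ : G →* L₁) (p₂ : G →* L₂) (N₁ : Subgroup L₁) (N₂ : Subgroup L₂) : Prop :=
  IsWitnessSystem p₁ p₂ ∧ TriviallyExtendable p₁ N₁ ∧ TriviallyExtendable p₂ N₂

/-- A good witness system associated with a pair of group sequences. -/
def GroupSequence.IsGoodWitnessSystem {ℓ : ℕ} (S₁ S₂ : GroupSequence.{u} ℓ) {G : Type u}
    [Group G] (p₁ : G →* S₁.top) (p₂ : G →* S₂.top) : Prop :=
  _root_.IsGoodWitnessSystem p₁ p₂ S₁.topKer S₂.topKer

/-! The induction on length proves more: any extensions `E₁`, `E₂` of the top groups `L₁`, `L₂` with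
isomorphic kernels have a good witness system. In length one, `L₁ ≅ L₂` and the fibre product works.
Otherwise let `Kᵢ` be the kernel of `Lᵢ → Rᵢ`. By `exists_cover` there are covers `Dᵢ → Eᵢ` whose
kernels over `Rᵢ` are isomorphic; induction applies to `Dᵢ → Rᵢ`, and `IsGoodWitnessSystem.comp`
brings the result back to `Eᵢ`.

The cover `D₁` is a fibre product over `L₁` of two kinds of extension. The first are twists of `E₁`
by automorphisms of `L₁`, one for each coset in `L₂ ⧸ K₂`, acting on `K₁ ≅ K₂` as conjugation by
coset representatives; the hypothesis supplies them. The second is pulled back from a wreath product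
built on `E₂`, along the monomial embedding of `L₁`; over `K₁` it becomes a product of twists of
`E₂` by representatives of `L₁ ⧸ K₁`. `D₂` is built with the roles exchanged. Over `K₁ ≅ K₂` both
consist of the same twists of `E₁` and `E₂`, so these parts are isomorphic. -/

/-! ### Trivial extendability and composition of witness systems -/

section TriviallyExtendable

variable {G H L : Type u} [Group G] [Group H] [Group L]

/-- A homomorphism is trivially extendable at `N` if it has a section over `N` that commutes with
the kernel. -/
theorem TriviallyExtendable.of_section (p : G →* H) (N : Subgroup H) (j : N →* G)
    (hj : ∀ n, p (j n) = n) (hc : ∀ n, ∀ x ∈ p.ker, Commute (j n) x) :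
    TriviallyExtendable p N := by
  intro M hM
  let i : M →* G := j.comp (Subgroup.inclusion hM)
  have hi : ∀ m, p (i m) = m := fun m => hj _
  let φ : M × p.ker →* G := i.noncommCoprod p.ker.subtype fun m x => hc _ _ x.2
  have hφ : ∀ y, φ y = i y.1 * y.2 := fun y => rfl
  have hpφ : ∀ y, p (φ y) = y.1 := fun y => by
    rw [hφ, map_mul, hi, (MonoidHom.mem_ker).1 y.2.2, mul_one]
  let ψ : M × p.ker →* M.comap p := φ.codRestrict _ fun y => by
    rw [Subgroup.mem_comap, hpφ]; exact y.1.2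
  refine ⟨(MulEquiv.ofBijective ψ ⟨?_, ?_⟩).symm⟩
  · rw [injective_iff_map_eq_one]
    rintro ⟨m, x⟩ hy
    have hy : φ (m, x) = 1 := congrArg Subtype.val hy
    have hm : m = 1 := by
      have := hpφ (m, x)
      rw [hy, map_one] at this
      exact Subtype.ext this.symm
    subst hm
    rw [hφ, map_one, one_mul] at hy
    exact Prod.ext rfl (Subtype.ext hy)
  · rintro ⟨g, hg⟩
    refine ⟨(⟨p g, hg⟩, ⟨(i ⟨p g, hg⟩)⁻¹ * g, ?_⟩), Subtype.ext ?_⟩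
    · rw [MonoidHom.mem_ker, map_mul, map_inv, hi, inv_mul_cancel]
    · change φ _ = g
      rw [hφ, mul_inv_cancel_left]

theorem TriviallyExtendable.nonempty_ker_comp_equiv {p : G →* H} {B : Subgroup H}
    (hp : TriviallyExtendable p B) (r : H →* L) (hr : r.ker ≤ B) :
    Nonempty ((r.comp p).ker ≃* r.ker × p.ker) :=
  hp r.ker hr

/-- The preimage of `M` splits as `M × r.ker × p.ker`, and the last two factors reassemble to the
kernel of the composite, because `p` also splits over `r.ker`. -/
theorem TriviallyExtendable.comp {p : G →* H} {B : Subgroup H} (hp : TriviallyExtendable p B)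
    {r : H →* L} {N : Subgroup L} (hr : TriviallyExtendable r N) (hN : N.comap r ≤ B) :
    TriviallyExtendable (r.comp p) N := by
  intro M hM
  have hMB : M.comap r ≤ B := (Subgroup.comap_mono hM).trans hN
  obtain ⟨a⟩ := hp _ hMB
  obtain ⟨b⟩ := hr M hM
  obtain ⟨c⟩ := hp.nonempty_ker_comp_equiv r ((r.ker_le_comap M).trans hMB)
  exact ⟨a.trans ((b.prodCongr (.refl _)).trans (MulEquiv.prodAssoc.trans
    ((MulEquiv.refl _).prodCongr c.symm)))⟩

end TriviallyExtendable

theorem IsWitnessSystem.compatibleGroups {G L₁ L₂ : Type u} [Group G] [Group L₁] [Group L₂]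
    {p₁ : G →* L₁} {p₂ : G →* L₂} (h : IsWitnessSystem p₁ p₂) : CompatibleGroups L₁ L₂ := by
  obtain ⟨hG, h₁, h₂, e⟩ := h
  exact ⟨G, _, hG, p₁.ker, p₂.ker, inferInstance, inferInstance, e,
    ⟨(QuotientGroup.quotientKerEquivOfSurjective p₁ h₁).symm⟩,
    ⟨(QuotientGroup.quotientKerEquivOfSurjective p₂ h₂).symm⟩⟩

/-- A good witness system for extensions `D₁`, `D₂` of `E₁`, `E₂` gives one for `E₁`, `E₂`. -/
theorem IsGoodWitnessSystem.comp {G D₁ D₂ E₁ E₂ : Type u} [Group G] [Group D₁] [Group D₂]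
    [Group E₁] [Group E₂] {p₁ : G →* D₁} {p₂ : G →* D₂} {B₁ : Subgroup D₁} {B₂ : Subgroup D₂}
    (h : IsGoodWitnessSystem p₁ p₂ B₁ B₂) {r₁ : D₁ →* E₁} {r₂ : D₂ →* E₂}
    (hr₁ : Function.Surjective r₁) (hr₂ : Function.Surjective r₂)
    (hker : Nonempty (r₁.ker ≃* r₂.ker)) {N₁ : Subgroup E₁} {N₂ : Subgroup E₂}
    (h₁ : TriviallyExtendable r₁ N₁) (h₂ : TriviallyExtendable r₂ N₂)
    (hN₁ : N₁.comap r₁ ≤ B₁) (hN₂ : N₂.comap r₂ ≤ B₂) :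
    IsGoodWitnessSystem (r₁.comp p₁) (r₂.comp p₂) N₁ N₂ := by
  obtain ⟨⟨hG, s₁, s₂, ⟨e⟩⟩, t₁, t₂⟩ := h
  obtain ⟨k⟩ := hker
  obtain ⟨a₁⟩ := t₁.nonempty_ker_comp_equiv r₁ ((r₁.ker_le_comap N₁).trans hN₁)
  obtain ⟨a₂⟩ := t₂.nonempty_ker_comp_equiv r₂ ((r₂.ker_le_comap N₂).trans hN₂)
  exact ⟨⟨hG, hr₁.comp s₁, hr₂.comp s₂, ⟨a₁.trans ((k.prodCongr e).trans a₂.symm)⟩⟩,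
    t₁.comp h₁ hN₁, t₂.comp h₂ hN₂⟩

/-! ### Fibre products -/

section FibreProduct

variable {E₁ E₂ Q : Type u} [Group E₁] [Group E₂] [Group Q]

/-- The fibre product of two extensions of `Q`. -/
def fibreProduct (π₁ : E₁ →* Q) (π₂ : E₂ →* Q) : Subgroup (E₁ × E₂) :=
  (π₁.comp (.fst E₁ E₂)).eqLocus (π₂.comp (.snd E₁ E₂))

theorem mem_fibreProduct {π₁ : E₁ →* Q} {π₂ : E₂ →* Q} {x : E₁ × E₂} :
    x ∈ fibreProduct π₁ π₂ ↔ π₁ x.1 = π₂ x.2 := Iff.rfl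

/-- The fibre product of two extensions of `Q` with isomorphic kernels is a good witness system. -/
theorem isGoodWitnessSystem_fibreProduct [Finite E₁] [Finite E₂] {π₁ : E₁ →* Q} {π₂ : E₂ →* Q}
    (h₁ : Function.Surjective π₁) (h₂ : Function.Surjective π₂) (e : π₁.ker ≃* π₂.ker) :
    IsGoodWitnessSystem ((MonoidHom.fst E₁ E₂).comp (fibreProduct π₁ π₂).subtype)
      ((MonoidHom.snd E₁ E₂).comp (fibreProduct π₁ π₂).subtype) π₁.ker π₂.ker := by
  let p₁ := (MonoidHom.fst E₁ E₂).comp (fibreProduct π₁ π₂).subtype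
  let p₂ := (MonoidHom.snd E₁ E₂).comp (fibreProduct π₁ π₂).subtype
  let j₁ : π₁.ker →* fibreProduct π₁ π₂ :=
    ((MonoidHom.inl E₁ E₂).comp π₁.ker.subtype).codRestrict _ fun x => by
      simp [mem_fibreProduct, MonoidHom.mem_ker.1 x.2]
  let j₂ : π₂.ker →* fibreProduct π₁ π₂ :=
    ((MonoidHom.inr E₁ E₂).comp π₂.ker.subtype).codRestrict _ fun x => by
      simp [mem_fibreProduct, MonoidHom.mem_ker.1 x.2]
  have hk₁ : ∀ x ∈ p₁.ker, x.1.1 = 1 := fun x hx => hx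
  have hk₂ : ∀ x ∈ p₂.ker, x.1.2 = 1 := fun x hx => hx
  let k₁ : π₂.ker ≃* p₁.ker :=
    { toFun x := ⟨j₂ x, rfl⟩
      invFun x := ⟨x.1.1.2, by
        rw [MonoidHom.mem_ker, ← mem_fibreProduct.1 x.1.2, hk₁ x.1 x.2, map_one]⟩
      left_inv _ := rfl
      right_inv x := Subtype.ext (Subtype.ext (Prod.ext (hk₁ x.1 x.2).symm rfl))
      map_mul' x y := Subtype.ext (map_mul j₂ x y) }
  let k₂ : π₁.ker ≃* p₂.ker :=
    { toFun x := ⟨j₁ x, rfl⟩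
      invFun x := ⟨x.1.1.1, by
        rw [MonoidHom.mem_ker, mem_fibreProduct.1 x.1.2, hk₂ x.1 x.2, map_one]⟩
      left_inv _ := rfl
      right_inv x := Subtype.ext (Subtype.ext (Prod.ext rfl (hk₂ x.1 x.2).symm))
      map_mul' x y := Subtype.ext (map_mul j₁ x y) }
  -- The kernel of each projection is a copy of the kernel of the other extension, so it commutes
  -- with the section `j₁` or `j₂`, which lives in the complementary coordinate.
  refine ⟨⟨inferInstance, fun x => ?_, fun x => ?_, ⟨k₁.symm.trans (e.symm.trans k₂)⟩⟩,
    .of_section _ _ j₁ (fun _ => rfl) fun n x hx => ?_,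
    .of_section _ _ j₂ (fun _ => rfl) fun n x hx => ?_⟩
  · obtain ⟨y, hy⟩ := h₂ (π₁ x)
    exact ⟨⟨(x, y), hy.symm⟩, rfl⟩
  · obtain ⟨y, hy⟩ := h₁ (π₂ x)
    exact ⟨⟨(y, x), hy⟩, rfl⟩
  · have := hk₁ x hx
    exact Subtype.ext (Prod.ext (by simp [this])
      ((one_mul x.1.2).trans (mul_one x.1.2).symm))
  · have := hk₂ x hx
    exact Subtype.ext (Prod.ext ((one_mul x.1.1).trans (mul_one x.1.1).symm)
      (by simp [this]))

end FibreProduct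

/-! ### The monomial cocycle of a subgroup -/

section CosetCocycle

variable {L : Type u} [Group L] (K : Subgroup L)

theorem cosetCocycle_mem (l : L) (q : L ⧸ K) : q.out⁻¹ * l * (l⁻¹ • q).out ∈ K := by
  have h : ((l⁻¹ * q.out : L) : L ⧸ K) = ((l⁻¹ • q).out : L) := by
    rw [QuotientGroup.out_eq', ← smul_eq_mul, ← MulAction.Quotient.smul_coe,
      QuotientGroup.out_eq']
  simpa [mul_assoc] using QuotientGroup.eq.1 h

/-- The cocycle of the monomial embedding of `L` into the wreath product of `K` with the
permutations of `L ⧸ K`. -/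
noncomputable def cosetCocycle (l : L) (q : L ⧸ K) : K :=
  ⟨q.out⁻¹ * l * (l⁻¹ • q).out, cosetCocycle_mem K l q⟩

theorem cosetCocycle_one (q : L ⧸ K) : cosetCocycle K 1 q = 1 :=
  Subtype.ext (by simp [cosetCocycle])

theorem cosetCocycle_mul (l m : L) (q : L ⧸ K) :
    cosetCocycle K (l * m) q = cosetCocycle K l q * cosetCocycle K m (l⁻¹ • q) :=
  Subtype.ext (by simp [cosetCocycle, mul_smul, mul_assoc])

theorem cosetCocycle_inv (l : L) (q : L ⧸ K) :
    cosetCocycle K l⁻¹ q = (cosetCocycle K l (l • q))⁻¹ :=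
  Subtype.ext (by simp [cosetCocycle, mul_assoc])

theorem inv_smul_coset_of_mem [K.Normal] {k : L} (hk : k ∈ K) (q : L ⧸ K) : k⁻¹ • q = q := by
  induction q using QuotientGroup.induction_on with
  | H x =>
    rw [MulAction.Quotient.smul_coe, QuotientGroup.eq]
    simpa [mul_assoc] using Subgroup.Normal.conj_mem' ‹K.Normal› k hk x

/-- A normal `K` fixes every coset, so over `K` the monomial embedding is diagonal, with conjugates
of `k` as entries. -/
theorem cosetCocycle_coe [K.Normal] (k : K) (q : L ⧸ K) :
    cosetCocycle K k q = MulAut.conjNormal q.out⁻¹ k :=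
  Subtype.ext (by simp [cosetCocycle, inv_smul_coset_of_mem K k.2])

end CosetCocycle

/-! ### The covers of the two extensions -/

section MonomialCover

variable {L L' E E' : Type u} [Group L] [Group L'] [Group E] [Group E']
  {K' : Subgroup L'} {K : Subgroup L}

/-- Let `E` and `E'` be extensions of `L` and `L'`, let `σ : K ≃* K'` be an isomorphism between
subgroups of `L` and `L'` and let `α` be a family of automorphisms of `L`. This is the fibre
product over `L` of the twists of `E` by the `α t` and of the monomial extension of `L` induced
from the extension of `K ≃* K'` given by `E'`. -/
def monomialCover (π : E →* L) (ϖ : E' →* L') (σ : K ≃* K') (α : L' ⧸ K' → MulAut L) :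
    Subgroup ((((L ⧸ K) → E') ⋊[mulAutArrow] L) × ((L' ⧸ K') → E)) where
  carrier := {x | (∀ q, ϖ (x.1.left q) = σ (cosetCocycle K x.1.right q)) ∧
    ∀ t, π (x.2 t) = α t x.1.right}
  one_mem' := ⟨fun q => by simp [cosetCocycle_one], fun t => by simp⟩
  mul_mem' := by
    rintro x y ⟨hx, hx'⟩ ⟨hy, hy'⟩
    refine ⟨fun q => ?_, fun t => ?_⟩
    · change ϖ (x.1.left q * y.1.left (x.1.right⁻¹ • q)) =
        σ (cosetCocycle K (x.1.right * y.1.right) q)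
      rw [map_mul, hx, hy, cosetCocycle_mul, map_mul, Subgroup.coe_mul]
    · change π (x.2 t * y.2 t) = α t (x.1.right * y.1.right)
      rw [map_mul, map_mul, hx', hy']
  inv_mem' := by
    rintro x ⟨hx, hx'⟩
    refine ⟨fun q => ?_, fun t => ?_⟩
    · change ϖ (x.1.left ((x.1.right⁻¹)⁻¹ • q))⁻¹ = σ (cosetCocycle K x.1.right⁻¹ q)
      rw [inv_inv, map_inv, hx, cosetCocycle_inv, map_inv, Subgroup.coe_inv]
    · change π (x.2 t)⁻¹ = α t x.1.right⁻¹
      rw [map_inv, map_inv, hx']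

namespace monomialCover

variable {π : E →* L} {ϖ : E' →* L'} {σ : K ≃* K'} {α : L' ⧸ K' → MulAut L}

instance [Finite L] [Finite L'] [Finite E] [Finite E'] : Finite (monomialCover π ϖ σ α) :=
  have : Finite (((L ⧸ K) → E') ⋊[mulAutArrow] L) := .of_equiv _ SemidirectProduct.equivProd.symm
  inferInstance

@[ext]
theorem ext {x y : monomialCover π ϖ σ α} (h₁ : ∀ q, x.1.1.left q = y.1.1.left q)
    (h₂ : x.1.1.right = y.1.1.right) (h₃ : ∀ t, x.1.2 t = y.1.2 t) : x = y :=
  Subtype.ext (Prod.ext (SemidirectProduct.ext (funext h₁) h₂) (funext h₃))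

theorem left_mul (x y : monomialCover π ϖ σ α) (q : L ⧸ K) :
    (x * y).1.1.left q = x.1.1.left q * y.1.1.left (x.1.1.right⁻¹ • q) := rfl

variable (π ϖ σ α) in
/-- The projection of the cover to the twist of `E` by `α t`. -/
def proj (t : L' ⧸ K') : monomialCover π ϖ σ α →* E :=
  ((Pi.evalMonoidHom _ t).comp (.snd _ _)).comp (monomialCover π ϖ σ α).subtype

theorem proj_apply (t : L' ⧸ K') (x : monomialCover π ϖ σ α) :
    proj π ϖ σ α t x = x.1.2 t := rfl

theorem π_proj (t : L' ⧸ K') (x : monomialCover π ϖ σ α) :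
    π (proj π ϖ σ α t x) = α t x.1.1.right := x.2.2 t

theorem right_eq_one {t : L' ⧸ K'} {x : monomialCover π ϖ σ α}
    (hx : π (proj π ϖ σ α t x) = 1) : x.1.1.right = 1 := by
  rwa [π_proj, map_eq_one_iff _ (α t).injective] at hx

theorem proj_surjective (hπ : Function.Surjective π) (hϖ : Function.Surjective ϖ)
    (t : L' ⧸ K') : Function.Surjective (proj π ϖ σ α t) := by
  classical
  intro e
  -- This `l` makes `e` admissible at `t`; the other coordinates are arbitrary lifts.
  let l := (α t).symm (π e)
  choose f hf using fun q => hϖ (σ (cosetCocycle K l q))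
  choose g hg using fun s => hπ (α s l)
  refine ⟨⟨(⟨f, l⟩, Function.update g t e), hf, fun s => ?_⟩, ?_⟩
  · obtain rfl | hs := eq_or_ne s t
    · simp [l]
    · simp [hs, hg]
  · simp [proj_apply]

variable (π ϖ σ α) in
/-- The element of the cover given by elements of the kernels of `π` and `ϖ`. -/
def ofKer (f : L ⧸ K → ϖ.ker) (g : L' ⧸ K' → π.ker) : monomialCover π ϖ σ α :=
  ⟨(⟨fun q => f q, 1⟩, fun t => g t),
    fun q => by simp [cosetCocycle_one, MonoidHom.mem_ker.1 (f q).2],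
    fun t => by simp [MonoidHom.mem_ker.1 (g t).2]⟩

theorem ofKer_mul (f f' : L ⧸ K → ϖ.ker) (g g' : L' ⧸ K' → π.ker) :
    ofKer π ϖ σ α (f * f') (g * g') = ofKer π ϖ σ α f g * ofKer π ϖ σ α f' g' := by
  ext <;> simp [ofKer]

theorem exists_eq_ofKer {x : monomialCover π ϖ σ α} (hx : x.1.1.right = 1) :
    ∃ f g, x = ofKer π ϖ σ α f g := by
  refine ⟨fun q => ⟨x.1.1.left q, ?_⟩, fun t => ⟨x.1.2 t, ?_⟩, ?_⟩
  · rw [MonoidHom.mem_ker, x.2.1, hx, cosetCocycle_one, map_one, Subgroup.coe_one]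
  · rw [MonoidHom.mem_ker, x.2.2, hx, map_one]
  · ext <;> simp [ofKer, hx]

theorem ofKer_injective {f f' : L ⧸ K → ϖ.ker} {g g' : L' ⧸ K' → π.ker}
    (h : ofKer π ϖ σ α f g = ofKer π ϖ σ α f' g') : f = f' ∧ g = g' := by
  have h := congrArg Subtype.val h
  exact ⟨funext fun q => Subtype.ext (congrFun (congrArg (fun x => x.1.left) h) q),
    funext fun t => Subtype.ext (congrFun (congrArg (fun x => x.2) h) t)⟩

-- The section puts `n` in coordinate `t`. An element of the kernel lies over `1` and is trivial at
-- `t`, and over `1` multiplication is coordinatewise, so the two commute.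
open Classical in
theorem triviallyExtendable_proj (t : L' ⧸ K') :
    TriviallyExtendable (proj π ϖ σ α t) π.ker := by
  refine .of_section _ _
    (.mk' (fun n => ofKer π ϖ σ α 1 (Pi.mulSingle t n)) fun m n => ?_) (fun n => ?_)
    fun n x hx => ?_
  · rw [← ofKer_mul, mul_one, Pi.mulSingle_mul]
  · simp [proj_apply, ofKer]
  · obtain ⟨f, g, rfl⟩ := exists_eq_ofKer (right_eq_one (t := t) (x := x) (by
      rw [MonoidHom.mem_ker.1 hx, map_one]))
    have hg : g t = 1 := Subtype.ext hx
    change ofKer π ϖ σ α _ _ * _ = _ * ofKer π ϖ σ α _ _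
    rw [← ofKer_mul, ← ofKer_mul, mul_one, one_mul]
    congr 1
    funext s
    obtain rfl | hs := eq_or_ne s t
    · simp [hg]
    · simp [hs]

open Classical in
variable (π ϖ σ α) in
/-- The elements of the kernel of a projection given by elements of the kernels of `π` and `ϖ`. -/
noncomputable def toKerProj (t : L' ⧸ K') :
    (L ⧸ K → ϖ.ker) × ({s : L' ⧸ K' // s ≠ t} → π.ker) →* (proj π ϖ σ α t).ker :=
  MonoidHom.mk' (fun y => ⟨ofKer π ϖ σ α y.1 fun s => if h : s = t then 1 else y.2 ⟨s, h⟩, by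
    simp [MonoidHom.mem_ker, proj_apply, ofKer]⟩) fun y z => Subtype.ext (by
      refine Eq.trans ?_ (ofKer_mul _ _ _ _)
      refine congrArg (ofKer π ϖ σ α _) (funext fun s => ?_)
      by_cases h : s = t <;> simp [h])

theorem toKerProj_bijective (t : L' ⧸ K') : Function.Bijective (toKerProj π ϖ σ α t) := by
  refine ⟨fun y z h => ?_, fun ⟨x, hx⟩ => ?_⟩
  · obtain ⟨h₁, h₂⟩ := ofKer_injective (congrArg Subtype.val h)
    refine Prod.ext h₁ (funext fun s => ?_)
    simpa [s.2] using congrFun h₂ s.1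
  · obtain ⟨f, g, rfl⟩ := exists_eq_ofKer (right_eq_one (t := t) (x := x) (by
      rw [MonoidHom.mem_ker.1 hx, map_one]))
    refine ⟨(f, fun s => g s), Subtype.ext ?_⟩
    change ofKer π ϖ σ α _ _ = _
    congr 1
    funext s
    by_cases h : s = t
    · subst h
      simpa using (Subtype.ext hx : g s = 1).symm
    · simp [h]

/-- If `π` and `ϖ` have isomorphic kernels, so do the projections of the two covers. -/
theorem nonempty_ker_proj_equiv (ν : π.ker ≃* ϖ.ker)
    {β : L ⧸ K → MulAut L'} (t : L' ⧸ K') (q : L ⧸ K) :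
    Nonempty ((proj π ϖ σ α t).ker ≃* (proj ϖ π σ.symm β q).ker) := by
  -- Each kernel has one factor for every coset of either kind but one; which kind lacks a coset is
  -- immaterial, as `π.ker ≃* ϖ.ker`.
  have e : (L ⧸ K) ⊕ {s : L' ⧸ K' // s ≠ t} ≃ (L' ⧸ K') ⊕ {s : L ⧸ K // s ≠ q} := by
    classical
    exact ((Equiv.optionSubtypeNe q).symm.trans (Equiv.optionEquivSumPUnit.{0} _)
      |>.sumCongr (.refl _)).trans <| (Equiv.sumAssoc _ _ _).trans <| (Equiv.sumComm _ _).trans <|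
      ((Equiv.sumComm _ _).trans
        ((Equiv.optionEquivSumPUnit.{0} _).symm.trans (Equiv.optionSubtypeNe t))).sumCongr (.refl _)
  let a₁ := MulEquiv.ofBijective _ (toKerProj_bijective (π := π) (ϖ := ϖ) (σ := σ) (α := α) t)
  let a₂ := MulEquiv.ofBijective _
    (toKerProj_bijective (π := ϖ) (ϖ := π) (σ := σ.symm) (α := β) q)
  let sumEquiv (A B : Type u) : (A → π.ker) × (B → π.ker) ≃* (A ⊕ B → π.ker) :=
    { (Equiv.sumArrowEquivProdArrow A B π.ker).symm with
      map_mul' := fun x y => funext fun s => by cases s <;> rfl }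
  exact ⟨a₁.symm.trans <| (((MulEquiv.arrowCongr (.refl _) ν.symm).prodCongr (.refl _)).trans <|
    (sumEquiv _ _).trans <| (MulEquiv.arrowCongr e (.refl _)).trans <| (sumEquiv _ _).symm.trans <|
    (MulEquiv.refl _).prodCongr (MulEquiv.arrowCongr (.refl _) ν)).trans a₂⟩

variable (π ϖ σ α) in
/-- The part of the cover lying over `K`. -/
def overK : Subgroup (monomialCover π ϖ σ α) :=
  K.comap ((SemidirectProduct.rightHom.comp (.fst _ _)).comp (monomialCover π ϖ σ α).subtype)

/-- Each `α t` restricts to an automorphism of `K`, so twisting by it does not change the part over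
`K`. -/
theorem comap_proj_eq_overK [K'.Normal]
    (hα : ∀ t, ∀ k : K, α t k = σ.symm (MulAut.conjNormal t.out⁻¹ (σ k))) (t : L' ⧸ K') :
    K.comap (π.comp (proj π ϖ σ α t)) = overK π ϖ σ α := by
  ext x
  change π (proj π ϖ σ α t x) ∈ K ↔ x.1.1.right ∈ K
  rw [π_proj]
  refine ⟨fun h => ?_, fun h => ?_⟩
  · have := hα t (σ.symm ((MulAut.conjNormal t.out⁻¹).symm (σ ⟨_, h⟩)))
    rw [MulEquiv.apply_symm_apply, MulEquiv.apply_symm_apply, MulEquiv.symm_apply_apply] at this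
    rw [← (α t).injective this]
    exact Subtype.prop _
  · rw [hα t ⟨_, h⟩]
    exact Subtype.prop _

section Swap

variable {β : L ⧸ K → MulAut L'} [K'.Normal] [K.Normal]

/-- Over `K ≃* K'`, the cover does not change if the two extensions are swapped. -/
def swap (hα : ∀ t, ∀ k : K, α t k = σ.symm (MulAut.conjNormal t.out⁻¹ (σ k)))
    (hβ : ∀ q, ∀ k : K', β q k = σ (MulAut.conjNormal q.out⁻¹ (σ.symm k))) :
    overK π ϖ σ α →* overK ϖ π σ.symm β :=
  MonoidHom.mk' (fun x => ⟨⟨(⟨x.1.1.2, σ ⟨_, x.2⟩⟩, x.1.1.1.left), by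
      refine ⟨fun t => ?_, fun q => ?_⟩
      · refine (x.1.2.2 t).trans ((hα t ⟨_, x.2⟩).trans ?_)
        rw [cosetCocycle_coe]
      · refine (x.1.2.1 q).trans (Eq.trans ?_ (hβ q _).symm)
        rw [MulEquiv.symm_apply_apply, ← cosetCocycle_coe]
        rfl⟩, (σ _).2⟩) fun x y => by
    -- Over `K` and `K'` no coset moves, so both semidirect products multiply coordinatewise.
    have hx : ∀ q : L ⧸ K, x.1.1.1.right⁻¹ • q = q := inv_smul_coset_of_mem K x.2
    have hx' : ∀ t : L' ⧸ K', (σ ⟨_, x.2⟩ : L')⁻¹ • t = t := inv_smul_coset_of_mem K' (σ _).2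
    refine Subtype.ext (monomialCover.ext (fun t => ?_) ?_ fun q => ?_)
    · refine Eq.trans ?_ (left_mul _ _ _).symm
      exact congrArg (fun s => x.1.1.2 t * y.1.1.2 s) (hx' t).symm
    · exact congrArg Subtype.val (map_mul σ ⟨_, x.2⟩ ⟨_, y.2⟩)
    · exact congrArg (fun s => x.1.1.1.left q * y.1.1.1.left s) (hx q)

theorem nonempty_overK_equiv
    (hα : ∀ t, ∀ k : K, α t k = σ.symm (MulAut.conjNormal t.out⁻¹ (σ k)))
    (hβ : ∀ q, ∀ k : K', β q k = σ (MulAut.conjNormal q.out⁻¹ (σ.symm k))) :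
    Nonempty (overK π ϖ σ α ≃* overK ϖ π σ.symm β) :=
  ⟨MonoidHom.toMulEquiv (swap hα hβ) (swap (σ := σ.symm) hβ hα)
    (MonoidHom.ext fun x => Subtype.ext (monomialCover.ext (fun _ => rfl)
      (congrArg Subtype.val (σ.symm_apply_apply ⟨_, x.2⟩)) fun _ => rfl))
    (MonoidHom.ext fun x => Subtype.ext (monomialCover.ext (fun _ => rfl)
      (congrArg Subtype.val (σ.apply_symm_apply ⟨_, x.2⟩)) fun _ => rfl))⟩

end Swap

end monomialCover

end MonomialCover

/-! ### Covering two-step extensions -/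

/-- If the inner automorphisms of `L'` restricted to `K'` are carried by `τ` into restrictions of
automorphisms of `L`, then each of them is carried to the restriction of an automorphism of `L`. -/
theorem exists_mulAut_of_map_restrictAut_le {L L' : Type u} [Group L] [Group L'] {K : Subgroup L}
    {K' : Subgroup L'} [K'.Normal] (τ : K' ≃* K)
    (h : (restrictAut (innAut L') K').map (MulAut.congr τ).toMonoidHom ≤ restrictAut ⊤ K)
    (g : L') : ∃ α : MulAut L, ∀ k : K, α k = τ (MulAut.conjNormal g (τ.symm k)) := by
  have hg : MulAut.conjNormal g ∈ restrictAut (innAut L') K' := by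
    refine ⟨MulAut.conj g, ⟨g, rfl⟩, ?_, fun k => rfl⟩
    exact Subgroup.Normal.map_conj_eq K' g
  obtain ⟨α, -, -, hα⟩ := h (Subgroup.mem_map_of_mem _ hg)
  exact ⟨α, fun k => (hα k).symm⟩

/-- Two extensions `E₁ → L₁ → R₁` and `E₂ → L₂ → R₂` in two steps with isomorphic kernels are
covered by extensions of `R₁` and `R₂` with isomorphic kernels. -/
theorem exists_cover {E₁ E₂ L₁ L₂ R₁ R₂ : Type u} [Group E₁] [Group E₂] [Group L₁] [Group L₂]
    [Group R₁] [Group R₂] [Finite E₁] [Finite E₂] [Finite L₁] [Finite L₂]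
    {π₁ : E₁ →* L₁} {π₂ : E₂ →* L₂} (hπ₁ : Function.Surjective π₁) (hπ₂ : Function.Surjective π₂)
    (ν : π₁.ker ≃* π₂.ker) (ρ₁ : L₁ →* R₁) (ρ₂ : L₂ →* R₂) (σ : ρ₁.ker ≃* ρ₂.ker)
    (h₁ : (restrictAut (innAut L₁) ρ₁.ker).map (MulAut.congr σ).toMonoidHom ≤
      restrictAut ⊤ ρ₂.ker)
    (h₂ : (restrictAut (innAut L₂) ρ₂.ker).map (MulAut.congr σ.symm).toMonoidHom ≤
      restrictAut ⊤ ρ₁.ker) :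
    ∃ (D₁ D₂ : Type u) (_ : Group D₁) (_ : Group D₂) (_ : Finite D₁) (_ : Finite D₂)
      (r₁ : D₁ →* E₁) (r₂ : D₂ →* E₂), Function.Surjective r₁ ∧ Function.Surjective r₂ ∧
      Nonempty (r₁.ker ≃* r₂.ker) ∧ TriviallyExtendable r₁ π₁.ker ∧
      TriviallyExtendable r₂ π₂.ker ∧
      Nonempty (((ρ₁.comp π₁).comp r₁).ker ≃* ((ρ₂.comp π₂).comp r₂).ker) := by
  choose α hα using fun t : L₂ ⧸ ρ₂.ker => exists_mulAut_of_map_restrictAut_le σ.symm h₂ t.out⁻¹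
  choose β hβ using fun q : L₁ ⧸ ρ₁.ker => exists_mulAut_of_map_restrictAut_le σ h₁ q.out⁻¹
  -- Any two cosets would do.
  let t : L₂ ⧸ ρ₂.ker := 1
  let q : L₁ ⧸ ρ₁.ker := 1
  refine ⟨monomialCover π₁ π₂ σ α, monomialCover π₂ π₁ σ.symm β, inferInstance, inferInstance,
    inferInstance, inferInstance, monomialCover.proj π₁ π₂ σ α t,
    monomialCover.proj π₂ π₁ σ.symm β q, monomialCover.proj_surjective hπ₁ hπ₂ t,
    monomialCover.proj_surjective hπ₂ hπ₁ q, monomialCover.nonempty_ker_proj_equiv ν t q,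
    monomialCover.triviallyExtendable_proj t, monomialCover.triviallyExtendable_proj q, ?_⟩
  obtain ⟨e⟩ := monomialCover.nonempty_overK_equiv (π := π₁) (ϖ := π₂) hα hβ
  have e₁ : ((ρ₁.comp π₁).comp (monomialCover.proj π₁ π₂ σ α t)).ker =
      monomialCover.overK π₁ π₂ σ α := monomialCover.comap_proj_eq_overK hα t
  have e₂ : ((ρ₂.comp π₂).comp (monomialCover.proj π₂ π₁ σ.symm β q)).ker =
      monomialCover.overK π₂ π₁ σ.symm β :=
    monomialCover.comap_proj_eq_overK (σ := σ.symm) hβ q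
  exact ⟨(MulEquiv.subgroupCongr e₁).trans (e.trans (MulEquiv.subgroupCongr e₂.symm))⟩

/-! ### Induction along the sequences -/

namespace GroupSequence

/-- The sequence without its top group. -/
def truncate {n : ℕ} (S : GroupSequence.{u} (n + 1)) : GroupSequence.{u} n where
  obj i := S.obj i.castSucc
  obj_zero := S.obj_zero
  hom i := S.hom i.castSucc

/-- Extensions with isomorphic kernels of the top groups of two sequences have a good witness
system if the condition of `IsComp` holds at every step but the lowest one. -/
theorem exists_isGoodWitnessSystem_of_extension (n : ℕ) (S₁ S₂ : GroupSequence.{u} (n + 1))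
    (hS : S₁.Compatible S₂)
    (hC : ∀ i : Fin (n + 1), 1 ≤ (i : ℕ) →
      ∃ σ : (S₁.hom i).ker ≃* (S₂.hom i).ker,
        (restrictAut (innAut (S₁.obj i.succ)) (S₁.hom i).ker).map
            (MulAut.congr σ).toMonoidHom ≤ restrictAut ⊤ (S₂.hom i).ker ∧
        (restrictAut (innAut (S₂.obj i.succ)) (S₂.hom i).ker).map
            (MulAut.congr σ.symm).toMonoidHom ≤ restrictAut ⊤ (S₁.hom i).ker)
    (E₁ E₂ : Type u) [Group E₁] [Group E₂] [Finite E₁] [Finite E₂]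
    (π₁ : E₁ →* S₁.top) (π₂ : E₂ →* S₂.top)
    (hπ₁ : Function.Surjective π₁) (hπ₂ : Function.Surjective π₂) (ν : π₁.ker ≃* π₂.ker) :
    ∃ (G : Type u) (_ : Group G) (p₁ : G →* E₁) (p₂ : G →* E₂),
      _root_.IsGoodWitnessSystem p₁ p₂ π₁.ker π₂.ker := by
  induction n generalizing E₁ E₂ with
  | zero =>
    obtain ⟨e⟩ := hS.2.2 0
    have ker_eq_top (S : GroupSequence.{u} 1) : (S.hom 0).ker = ⊤ :=
      have : Subsingleton (S.obj (0 : Fin 1).castSucc) := S.obj_zero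
      eq_top_iff.2 fun x _ => Subsingleton.elim (α := S.obj (0 : Fin 1).castSucc) _ _
    let θ : S₁.top ≃* S₂.top := Subgroup.topEquiv.symm.trans
      ((MulEquiv.subgroupCongr (ker_eq_top S₁).symm).trans
        (e.trans ((MulEquiv.subgroupCongr (ker_eq_top S₂)).trans Subgroup.topEquiv)))
    have hker : (θ.toMonoidHom.comp π₁).ker = π₁.ker := by
      ext x; simp [MonoidHom.mem_ker]
    have := isGoodWitnessSystem_fibreProduct (π₁ := θ.toMonoidHom.comp π₁) (π₂ := π₂)
      (θ.surjective.comp hπ₁) hπ₂ ((MulEquiv.subgroupCongr hker).trans ν)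
    rw [hker] at this
    exact ⟨_, _, _, _, this⟩
  | succ n ih =>
    obtain ⟨σ, h₁, h₂⟩ := hC (Fin.last (n + 1)) (by simp)
    obtain ⟨D₁, D₂, _, _, _, _, r₁, r₂, hr₁, hr₂, hk, ht₁, ht₂, ⟨μ⟩⟩ :=
      exists_cover hπ₁ hπ₂ ν (S₁.hom (Fin.last (n + 1))) (S₂.hom (Fin.last (n + 1))) σ h₁ h₂
    obtain ⟨G, _, p₁, p₂, hG⟩ := ih S₁.truncate S₂.truncate
      ⟨fun i => hS.1 i.castSucc, fun i => hS.2.1 i.castSucc, fun i => hS.2.2 i.castSucc⟩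
      (fun i hi => hC i.castSucc hi) D₁ D₂ _ _
      (((hS.1 (Fin.last (n + 1))).comp hπ₁).comp hr₁)
      (((hS.2.1 (Fin.last (n + 1))).comp hπ₂).comp hr₂) μ
    refine ⟨G, _, _, _, hG.comp hr₁ hr₂ hk ht₁ ht₂ (fun x hx => ?_) fun x hx => ?_⟩
    · exact (congrArg (S₁.hom _) (MonoidHom.mem_ker.1 hx)).trans (map_one _)
    · exact (congrArg (S₂.hom _) (MonoidHom.mem_ker.1 hx)).trans (map_one _)

end GroupSequence

theorem theorem5 (ℓ : ℕ) (hℓ : 2 ≤ ℓ) (S₁ S₂ : GroupSequence.{u} ℓ) (h : IsComp S₁ S₂) :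
    (∃ (G : Type u) (_ : Group G) (p₁ : G →* S₁.top) (p₂ : G →* S₂.top),
      GroupSequence.IsGoodWitnessSystem S₁ S₂ p₁ p₂) ∧
    CompatibleGroups S₁.top S₂.top := by
  obtain ⟨n, rfl⟩ := Nat.exists_eq_add_of_le' hℓ
  obtain ⟨hS, hC⟩ := h
  obtain ⟨ν⟩ := hS.2.2 (Fin.last (n + 1))
  -- The top maps are themselves the extensions to start from, so no condition is needed at the top
  -- step.
  obtain ⟨G, _, p₁, p₂, hG⟩ := GroupSequence.exists_isGoodWitnessSystem_of_extension n
    S₁.truncate S₂.truncate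
    ⟨fun i => hS.1 i.castSucc, fun i => hS.2.1 i.castSucc, fun i => hS.2.2 i.castSucc⟩
    (fun i hi => hC i.castSucc hi (Nat.succ_lt_succ i.2)) S₁.top S₂.top
    (S₁.hom (Fin.last (n + 1))) (S₂.hom (Fin.last (n + 1))) (hS.1 _) (hS.2.1 _) ν
  exact ⟨⟨G, _, p₁, p₂, hG⟩, hG.1.compatibleGroups⟩
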